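/- Let $n\in\mathbb N$, let $H_S\in\mathbb C^{n\times n}$ be Hermitian and let $T\in(0,\infty]$. For $m\ge 1$, a Hermitian $H_B\in\mathbb C^{m\times m}$ and a unitary $U$ on $\mathbb C^n\otimes\mathbb C^m$ put $$\Phi_{T,m}(H_B,U):=\operatorname{tr}_B\Big(U\Big((\cdot)\otimes\frac{e^{-H_B/T}}{\operatorname{tr}(e^{-H_B/T})}\Big)U^*\Big)\ \text{ for } T<\infty,\qquad \Phi_{\infty,m}(H_B,U):=\operatorname{tr}_B\Big(U\Big((\cdot)\otimes\frac{\mathbb 1_m}{m}\Big)U^*\Big),$$ where $\operatorname{tr}_B$ is the partial trace over $\mathbb C^m$; these are linear maps on $\mathbb C^{n\times n}$. Let $$\mathsf{TO}(H_S,T):=\bigcup_{m\ge 1}\big\{\Phi_{T,m}(H_B,U): H_B\in\mathbb C^{m\times m}\text{ Hermitian},\ U\text{ unitary},\ U(H_S\otimes\mathbb 1+\mathbb 1\otimes H_B)U^*=H_S\otimes\mathbb 1+\mathbb 1\otimes H_B\big\}$$ be the set of thermal operations, and for real $r>0$ let $\mathsf{TO}^{r}_{\mathsf{Spin}}(H_S,T)$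 be the set of all maps $\Phi_{T,\beta_1+\ldots+\beta_m}(H_B,e^{iH_{\mathsf{tot}}})$ where $m\ge 1$, $\beta_1,\ldots,\beta_m\ge 1$ are integers, $H_B=\bigoplus_{j=1}^m jr\,\mathbb 1_{\beta_j}$, and $H_{\mathsf{tot}}$ is Hermitian on $\mathbb C^n\otimes\mathbb C^{\beta_1+\ldots+\beta_m}$ with $[H_{\mathsf{tot}},H_S\otimes\mathbb 1+\mathbb 1\otimes H_B]=0$. If $r>0$ is a real number such that the spectrum of $\operatorname{ad}_{H_S}=[H_S,\,\cdot\,]$ on $\mathbb C^{n\times n}$ satisfies $\sigma(\operatorname{ad}_{H_S})\subseteq r\mathbb Z$, then $$\overline{\mathsf{TO}(H_S,T)}=\overline{\mathsf{TO}^{r}_{\mathsf{Spin}}(H_S,T)},$$ the closures being taken in the finite-dimensional space of linear maps on $\mathbb C^{n\times n}$. -/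

import Mathlib

open scoped Kronecker Matrix ENNReal

noncomputable section

namespace ThermalOp

variable {ι κ : Type*} [Fintype ι] [DecidableEq ι] [Fintype κ] [DecidableEq κ]

/-- Partial trace over the second (bath) tensor factor. -/
def partialTraceBath : Matrix (ι × κ) (ι × κ) ℂ →ₗ[ℂ] Matrix ι ι ℂ where
  toFun X := Matrix.of fun i j => ∑ k, X (i, k) (j, k)
  map_add' X Y := by
    ext i j
    simp [Finset.sum_add_distrib]
  map_smul' c X := by
    ext i j
    simp [Finset.mul_sum]

/-- The Gibbs state `exp (-H / T) / tr (exp (-H / T))` of a Hamiltonian `H` at a finite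
temperature `T`. -/
def gibbsState (T : ℝ) (H : Matrix κ κ ℂ) : Matrix κ κ ℂ :=
  (Matrix.trace (NormedSpace.exp (-((1 / T : ℝ) : ℂ) • H)))⁻¹ •
    NormedSpace.exp (-((1 / T : ℝ) : ℂ) • H)

/-- The map `A ↦ tr_B (U (A ⊗ ω) Uᴴ)`, where `ω` is the Gibbs state of the bath Hamiltonian `HB`
at the finite temperature `T`, as a linear map on matrices. -/
def interactionLinearMap (T : ℝ) (HB : Matrix κ κ ℂ) (U : Matrix (ι × κ) (ι × κ) ℂ) :
    Matrix ι ι ℂ →ₗ[ℂ] Matrix ι ι ℂ where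
  toFun A := partialTraceBath (U * (A ⊗ₖ gibbsState T HB) * Uᴴ)
  map_add' A B := by
    rw [Matrix.add_kronecker, Matrix.mul_add, Matrix.add_mul, map_add]
  map_smul' c A := by
    rw [Matrix.smul_kronecker, Matrix.mul_smul, Matrix.smul_mul, map_smul, RingHom.id_apply]

/-- The same map as an element of the space of (automatically continuous) linear maps on the
finite-dimensional space of matrices, with the usual topology of that space. -/
def interactionMap (T : ℝ) (HB : Matrix κ κ ℂ) (U : Matrix (ι × κ) (ι × κ) ℂ) :
    Matrix ι ι ℂ →L[ℂ] Matrix ι ι ℂ :=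
  LinearMap.toContinuousLinearMap (interactionLinearMap T HB U)

/-- The map obtained from a bath `HB` at a temperature `T ∈ (0, ∞]`. At `T = ∞` the Gibbs state
is replaced by the maximally mixed state, i.e. by the Gibbs state of the identity. -/
def thermalMap (T : ℝ≥0∞) (HB : Matrix κ κ ℂ) (U : Matrix (ι × κ) (ι × κ) ℂ) :
    Matrix ι ι ℂ →L[ℂ] Matrix ι ι ℂ :=
  if T = ⊤ then interactionMap 1 1 U else interactionMap T.toReal HB U

/-- The Hamiltonian `HS ⊗ 1 + 1 ⊗ HB` of the uncoupled system and bath. -/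
def totalHamiltonian (HS : Matrix ι ι ℂ) (HB : Matrix κ κ ℂ) : Matrix (ι × κ) (ι × κ) ℂ :=
  HS ⊗ₖ (1 : Matrix κ κ ℂ) + (1 : Matrix ι ι ℂ) ⊗ₖ HB

/-- The adjoint map `ad H : A ↦ H * A - A * H` on matrices. Its spectrum is the Bohr spectrum
of `H`. -/
def adMap (H : Matrix ι ι ℂ) : Module.End ℂ (Matrix ι ι ℂ) :=
  LinearMap.mulLeft ℂ H - LinearMap.mulRight ℂ H

/-- The thermal operations with respect to the system Hamiltonian `HS` and the temperature `T`. -/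
def TO (HS : Matrix ι ι ℂ) (T : ℝ≥0∞) : Set (Matrix ι ι ℂ →L[ℂ] Matrix ι ι ℂ) :=
  {S | ∃ (m : ℕ) (HB : Matrix (Fin m) (Fin m) ℂ) (U : Matrix (ι × Fin m) (ι × Fin m) ℂ),
    0 < m ∧ HB.IsHermitian ∧ U ∈ Matrix.unitaryGroup (ι × Fin m) ℂ ∧
    U * totalHamiltonian HS HB * Uᴴ = totalHamiltonian HS HB ∧
    S = thermalMap T HB U}

/-- The spin Hamiltonian `⨁ j = 1, …, m, (j * r) 1_{β j}` with gap `r` and degeneracies `β`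
(`j` is shifted by one, as `Fin m` starts at zero). -/
def spinHamiltonian (r : ℝ) {m : ℕ} (β : Fin m → ℕ) :
    Matrix ((j : Fin m) × Fin (β j)) ((j : Fin m) × Fin (β j)) ℂ :=
  Matrix.blockDiagonal' fun j : Fin m =>
    ((((j : ℕ) + 1 : ℝ) * r : ℝ) : ℂ) • (1 : Matrix (Fin (β j)) (Fin (β j)) ℂ)

/-- The thermal operations whose bath is a spin Hamiltonian with gap `r`. -/
def TOSpin (r : ℝ) (HS : Matrix ι ι ℂ) (T : ℝ≥0∞) :
    Set (Matrix ι ι ℂ →L[ℂ] Matrix ι ι ℂ) :=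
  {S | ∃ (m : ℕ) (β : Fin m → ℕ)
      (Htot : Matrix (ι × ((j : Fin m) × Fin (β j))) (ι × ((j : Fin m) × Fin (β j))) ℂ),
    0 < m ∧ (∀ j, 0 < β j) ∧ Htot.IsHermitian ∧
    ⁅Htot, totalHamiltonian HS (spinHamiltonian r β)⁆ = 0 ∧
    S = thermalMap T (spinHamiltonian r β) (NormedSpace.exp (Complex.I • Htot))}

end ThermalOp

end

/-!
A thermal operation is the Gibbs-weighted mean of the channels contributed by the single levels of
its bath, whose Hamiltonian may be taken diagonal. Energy conservation forces the block of the
interaction between two bath levels to vanish unless their energy difference is a Bohr frequency,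
hence a multiple of `r`. The interaction therefore splits along the classes of bath energies
modulo `r`, and the operation is a mixture of operations whose bath energies lie in a single class
`c + ℤ r`; the offset `c` does not affect the Gibbs weights.

Putting `m` copies of one bath beside `n` copies of another mixes the two channels with weights
proportional to `m * Z` and `n * Z'`, where `Z` and `Z'` are the partition functions. Suitable `m`
and `n` approximate every ratio of weights, so the closure of the spin operations is convex. The
same device fills the unoccupied rungs of the energy ladder of a bath: an uncoupled bath that
occupies all of them is added with a weight tending to zero.
-/

open Filter Topology

theorem exists_nat_seq_tendsto_mul_div {a p : ℝ} (ha : 0 ≤ a) (hp : 0 < p) :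
    ∃ u : ℕ → ℕ, (∀ L, 0 < u L) ∧ Tendsto (fun L : ℕ => u L * p / L) atTop (𝓝 a) := by
  refine ⟨fun L => ⌊a / p * L⌋₊ + 1, fun L => Nat.succ_pos _, ?_⟩
  have hfloor : Tendsto (fun L : ℕ => (⌊a / p * L⌋₊ : ℝ) / L) atTop (𝓝 (a / p)) :=
    (tendsto_nat_floor_mul_div_atTop (div_nonneg ha hp.le)).comp tendsto_natCast_atTop_atTop
  have hlim := (hfloor.add (tendsto_inv_atTop_nhds_zero_nat (𝕜 := ℝ))).mul_const p
  rw [add_zero, div_mul_cancel₀ a hp.ne'] at hlim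
  refine hlim.congr fun L => ?_
  push_cast
  ring

theorem segment_subset_closure_of_nat_weights {V : Type*} [AddCommGroup V] [Module ℝ V]
    [TopologicalSpace V] [ContinuousAdd V] [ContinuousSMul ℝ V] {S : Set V} {x y : V} {p q : ℝ}
    (hp : 0 < p) (hq : 0 < q)
    (hS : ∀ m n : ℕ, 0 < m → 0 < n → (m * p + n * q)⁻¹ • ((m * p) • x + (n * q) • y) ∈ S) :
    segment ℝ x y ⊆ closure S := by
  rintro _ ⟨a, b, ha, hb, hab, rfl⟩
  obtain ⟨m, hm, hma⟩ := exists_nat_seq_tendsto_mul_div ha hp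
  obtain ⟨n, hn, hnb⟩ := exists_nat_seq_tendsto_mul_div hb hq
  have hlim := ((hma.add hnb).inv₀ (by simp [hab])).smul
    ((hma.smul_const x).add (hnb.smul_const y))
  rw [hab, inv_one, one_smul] at hlim
  refine mem_closure_of_tendsto hlim ((eventually_ne_atTop 0).mono fun L hL => ?_)
  have hL' : (L : ℝ) ≠ 0 := Nat.cast_ne_zero.mpr hL
  convert hS (m L) (n L) (hm L) (hn L) using 1
  match_scalars <;> field_simp

theorem convex_closure_of_segment_subset {V : Type*} [AddCommGroup V] [Module ℝ V]
    [TopologicalSpace V] [ContinuousAdd V] [ContinuousConstSMul ℝ V] {S : Set V}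
    (hS : ∀ x ∈ S, ∀ y ∈ S, segment ℝ x y ⊆ closure S) : Convex ℝ (closure S) := by
  intro x hx y hy a b ha hb hab
  rw [← closure_closure]
  exact map_mem_closure₂ (f := fun x y => a • x + b • y) (by fun_prop) hx hy
    fun x hx y hy => hS x hx y hy ⟨a, b, ha, hb, hab, rfl⟩

theorem univ_centerMass_subtype {R V α : Type*} [Field R] [AddCommGroup V] [Module R V]
    [Fintype α] (P : α → Prop) [DecidablePred P] (w : α → R) (z : α → V) :
    (Finset.univ : Finset {i // P i}).centerMass (fun i => w i) (fun i => z i) =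
      ({i | P i} : Finset α).centerMass w z := by
  simp only [Finset.centerMass]
  rw [Finset.sum_subtype {i | P i} (p := P) (by simp) w,
    Finset.sum_subtype {i | P i} (p := P) (by simp) fun i => w i • z i]

theorem centerMass_mem_of_fiberwise {R V α γ : Type*} [Field R] [LinearOrder R]
    [IsStrictOrderedRing R] [AddCommGroup V] [Module R V] [Fintype α] [Nonempty α] [DecidableEq γ]
    {K : Set V} (hK : Convex R K) {w : α → R} (hw : ∀ i, 0 < w i) (z : α → V) (q : α → γ)
    (h : ∀ i, (Finset.univ : Finset {j // q j = q i}).centerMass (fun j => w j)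
      (fun j => z j) ∈ K) :
    Finset.univ.centerMass w z ∈ K := by
  let fiber : γ → Finset α := fun c => {j | q j = c}
  have hfiber : ∀ c ∈ Finset.univ.image q, 0 < ∑ j ∈ fiber c, w j := by
    simp only [Finset.mem_image, Finset.mem_univ, true_and, forall_exists_index,
      forall_apply_eq_imp_iff]
    exact fun i => Finset.sum_pos (fun j _ => hw j) ⟨i, by simp [fiber]⟩
  have hmaps : ∀ i ∈ Finset.univ, q i ∈ Finset.univ.image q :=
    fun i _ => Finset.mem_image_of_mem q (Finset.mem_univ i)
  have hsplit : (Finset.univ.image q).centerMass (fun c => ∑ j ∈ fiber c, w j)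
      (fun c => (fiber c).centerMass w z) = Finset.univ.centerMass w z := by
    simp only [Finset.centerMass]
    rw [Finset.sum_fiberwise_of_maps_to hmaps,
      ← Finset.sum_fiberwise_of_maps_to hmaps fun j => w j • z j]
    congr 1
    exact Finset.sum_congr rfl fun c hc =>
      smul_inv_smul₀ (hfiber c hc).ne' (∑ j ∈ fiber c, w j • z j)
  rw [← hsplit]
  refine hK.centerMass_mem (fun c hc => (hfiber c hc).le) ?_ ?_
  · rw [Finset.sum_fiberwise_of_maps_to hmaps]
    exact Finset.sum_pos (fun i _ => hw i) Finset.univ_nonempty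
  · simp only [Finset.mem_image, Finset.mem_univ, true_and, forall_exists_index,
      forall_apply_eq_imp_iff]
    intro i
    rw [← univ_centerMass_subtype]
    exact h i

open scoped Matrix.Norms.L2Operator in
theorem exp_I_smul_mem_unitaryGroup {n : Type*} [Fintype n] [DecidableEq n] {H : Matrix n n ℂ}
    (hH : H.IsHermitian) : NormedSpace.exp (Complex.I • H) ∈ Matrix.unitaryGroup n ℂ :=
  (selfAdjoint.expUnitary ⟨H, hH⟩).2

theorem commute_star_of_mem_unitary {R : Type*} [Monoid R] [StarMul R] {u x : R}
    (hu : u ∈ unitary R) (h : Commute u x) : Commute (star u) x :=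
  h.units_inv_left (u := Unitary.toUnits ⟨u, hu⟩)

theorem conj_eq_iff_commute {R : Type*} [Monoid R] [StarMul R] {u x : R} (hu : u ∈ unitary R) :
    u * x * star u = x ↔ Commute u x :=
  (Units.mul_inv_eq_iff_eq_mul (Unitary.toUnits ⟨u, hu⟩))

open scoped Matrix.Norms.L2Operator in
theorem exists_isHermitian_exp_eq {n : Type*} [Fintype n] [DecidableEq n] {U : Matrix n n ℂ}
    (hU : U ∈ Matrix.unitaryGroup n ℂ) :
    ∃ H : Matrix n n ℂ, H.IsHermitian ∧ NormedSpace.exp (Complex.I • H) = U ∧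
      ∀ K, Commute U K → Commute H K := by
  have hnormal : IsStarNormal U := ⟨hU.1.trans hU.2.symm⟩
  have hcont : ∀ f : ℂ → ℂ, ContinuousOn f (spectrum ℂ U) :=
    (Matrix.finite_spectrum U).continuousOn
  refine ⟨cfc (fun z : ℂ => (z.arg : ℂ)) U, ?_, ?_, fun K hK =>
    hK.cfc (commute_star_of_mem_unitary hU hK) _⟩
  · change star _ = _
    simp [← cfc_star]
  · have hexp : (spectrum ℂ U).EqOn (fun z => Complex.exp (Complex.I * z.arg)) id := by
      intro z hz
      have hz : ‖z‖ = 1 := spectrum.norm_eq_one_of_unitary hU hz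
      simpa [hz, mul_comm] using Complex.norm_mul_exp_arg_mul_I z
    rw [← cfc_const_mul Complex.I _ U (hcont _),
      ← CFC.complex_exp_eq_normedSpace_exp (cfc_predicate _ _),
      ← cfc_comp' Complex.exp _ U Complex.continuous_exp.continuousOn (hcont _), cfc_congr hexp,
      cfc_id ℂ U]

namespace ThermalOp

section Levels

variable {ι κ : Type*} [Fintype ι] [DecidableEq ι] [Fintype κ]

/-- The contribution of the bath level `l` to an interaction with blocks `B`, namely the map
`A ↦ ∑ k, B k l * A * (B k l)ᴴ`. -/
noncomputable def levelChannel (B : Matrix κ κ (Matrix ι ι ℂ)) (l : κ) :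
    Matrix ι ι ℂ →L[ℂ] Matrix ι ι ℂ :=
  ∑ k, LinearMap.toContinuousLinearMap (LinearMap.mulLeftRight ℂ (B k l, (B k l)ᴴ))

theorem levelChannel_apply (B : Matrix κ κ (Matrix ι ι ℂ)) (l : κ) (A : Matrix ι ι ℂ) :
    levelChannel B l A = ∑ k, B k l * A * (B k l)ᴴ := by
  simp [levelChannel]

/-- The mixture of the level channels of an interaction `B` in which a bath level of energy `E l`
has the Gibbs weight `exp (-β * E l)`; here `β` is the inverse temperature. -/
noncomputable def gibbsChannel (β : ℝ) (E : κ → ℝ) (B : Matrix κ κ (Matrix ι ι ℂ)) :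
    Matrix ι ι ℂ →L[ℂ] Matrix ι ι ℂ :=
  Finset.univ.centerMass (fun l => Real.exp (-β * E l)) (levelChannel B)

theorem gibbsChannel_const_add (β c : ℝ) (E : κ → ℝ) (B : Matrix κ κ (Matrix ι ι ℂ)) :
    gibbsChannel β (fun k => c + E k) B = gibbsChannel β E B := by
  simp only [gibbsChannel, mul_add, Real.exp_add]
  exact Finset.centerMass_smul_left Finset.univ (w := fun l => Real.exp (-β * E l)) _
    (Real.exp_ne_zero (-β * c))

end Levels

section Blocks

variable {ι κ : Type*} [Fintype ι] [DecidableEq ι] [Fintype κ] [DecidableEq κ]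

/-- A matrix on the composite of system and bath, viewed as a matrix indexed by the bath whose
entries are matrices on the system. -/
noncomputable def bathBlocks : Matrix (ι × κ) (ι × κ) ℂ ≃⋆ₐ[ℂ] Matrix κ κ (Matrix ι ι ℂ) :=
  StarAlgEquiv.ofAlgEquiv ((Matrix.reindexAlgEquiv ℂ ℂ (Equiv.prodComm ι κ)).trans
    (Matrix.compAlgEquiv κ ι ℂ ℂ).symm) fun _ => rfl

theorem bathBlocks_mem_unitary_iff {U : Matrix (ι × κ) (ι × κ) ℂ} :
    bathBlocks U ∈ unitary _ ↔ U ∈ Matrix.unitaryGroup (ι × κ) ℂ := by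
  simp only [Unitary.mem_iff, ← map_star, ← map_mul, EmbeddingLike.map_eq_one_iff]

theorem partialTraceBath_eq_trace_bathBlocks (X : Matrix (ι × κ) (ι × κ) ℂ) :
    partialTraceBath X = (bathBlocks X).trace := by
  ext i j
  simp only [Matrix.trace, Matrix.sum_apply]
  rfl

theorem bathBlocks_kronecker_diagonal (A : Matrix ι ι ℂ) (c : κ → ℂ) :
    bathBlocks (A ⊗ₖ Matrix.diagonal c) = Matrix.diagonal fun k => c k • A := by
  ext k l i j
  change A i j * Matrix.diagonal c k l = _
  by_cases h : k = l <;> simp [h, mul_comm]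

theorem bathBlocks_totalHamiltonian (HS : Matrix ι ι ℂ) (c : κ → ℂ) :
    bathBlocks (totalHamiltonian HS (Matrix.diagonal c)) =
      Matrix.diagonal fun k => HS + c k • 1 := by
  rw [totalHamiltonian, ← Matrix.diagonal_one, map_add, bathBlocks_kronecker_diagonal,
    bathBlocks_kronecker_diagonal, Matrix.diagonal_add]
  simp only [one_smul]

theorem partialTraceBath_conj_kronecker_diagonal (U : Matrix (ι × κ) (ι × κ) ℂ)
    (A : Matrix ι ι ℂ) (c : κ → ℂ) :
    partialTraceBath (U * (A ⊗ₖ Matrix.diagonal c) * Uᴴ) =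
      ∑ l, c l • levelChannel (bathBlocks U) l A := by
  simp only [partialTraceBath_eq_trace_bathBlocks, map_mul, bathBlocks_kronecker_diagonal,
    levelChannel_apply, Finset.smul_sum]
  rw [Finset.sum_comm]
  refine Finset.sum_congr rfl fun k _ => ?_
  rw [Matrix.diag_apply, Matrix.mul_apply]
  refine Finset.sum_congr rfl fun l _ => ?_
  rw [Matrix.mul_diagonal, Matrix.mul_smul, Matrix.smul_mul]
  rfl

theorem gibbsState_diagonal (t : ℝ) (E : κ → ℝ) :
    gibbsState t (Matrix.diagonal fun k => (E k : ℂ)) =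
      Matrix.diagonal fun k =>
        (((∑ l, Real.exp (-t⁻¹ * E l))⁻¹ * Real.exp (-t⁻¹ * E k) : ℝ) : ℂ) := by
  have hexp : NormedSpace.exp (-((1 / t : ℝ) : ℂ) • Matrix.diagonal fun k => (E k : ℂ)) =
      Matrix.diagonal fun k => (Real.exp (-t⁻¹ * E k) : ℂ) := by
    rw [← Matrix.diagonal_smul, Matrix.exp_diagonal]
    congr 1
    ext k
    simp [Pi.coe_exp, ← Complex.exp_eq_exp_ℂ]
  rw [gibbsState, hexp, Matrix.trace_diagonal, ← Matrix.diagonal_smul]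
  congr 1
  ext k
  simp

theorem interactionMap_diagonal (t : ℝ) (E : κ → ℝ) (U : Matrix (ι × κ) (ι × κ) ℂ) :
    interactionMap t (Matrix.diagonal fun k => (E k : ℂ)) U =
      gibbsChannel t⁻¹ E (bathBlocks U) := by
  ext1 A
  change partialTraceBath (U * (A ⊗ₖ gibbsState t _) * Uᴴ) = _
  rw [gibbsState_diagonal, partialTraceBath_conj_kronecker_diagonal, gibbsChannel,
    Finset.centerMass, smul_apply, sum_apply, Finset.smul_sum]
  refine Finset.sum_congr rfl fun l _ => ?_
  rw [smul_apply, smul_smul, Complex.coe_smul]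

theorem thermalMap_diagonal (T : ℝ≥0∞) (E : κ → ℝ) (U : Matrix (ι × κ) (ι × κ) ℂ) :
    thermalMap T (Matrix.diagonal fun k => (E k : ℂ)) U =
      gibbsChannel T⁻¹.toReal E (bathBlocks U) := by
  rw [thermalMap]
  split_ifs with hT
  · have hone : (1 : Matrix κ κ ℂ) = Matrix.diagonal fun _ => ((1 : ℝ) : ℂ) := by simp
    rw [hone, interactionMap_diagonal]
    simpa [gibbsChannel, hT] using gibbsChannel_const_add 1 1 (fun _ => (0 : ℝ)) (bathBlocks U)
  · rw [interactionMap_diagonal, ENNReal.toReal_inv]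

end Blocks

section EnergyPreserving

variable {ι κ κ' : Type*} [Fintype ι] [DecidableEq ι] [Fintype κ] [DecidableEq κ] [Fintype κ']
  [DecidableEq κ']

/-- The condition on the blocks `B` of an interaction that it is unitary and conserves the total
energy for the bath levels `E`. Block by block, energy conservation says that `B k l` is an
eigenvector of `ad HS` for the energy `E l - E k` that the bath gives to the system. -/
structure IsEnergyPreserving (HS : Matrix ι ι ℂ) (E : κ → ℝ) (B : Matrix κ κ (Matrix ι ι ℂ)) :
    Prop where
  mem_unitary : B ∈ unitary (Matrix κ κ (Matrix ι ι ℂ))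
  adMap_apply : ∀ k l, adMap HS (B k l) = ((E l - E k : ℝ) : ℂ) • B k l

theorem isEnergyPreserving_bathBlocks_iff {HS : Matrix ι ι ℂ} {E : κ → ℝ}
    {U : Matrix (ι × κ) (ι × κ) ℂ} :
    IsEnergyPreserving HS E (bathBlocks U) ↔ U ∈ Matrix.unitaryGroup (ι × κ) ℂ ∧
      Commute U (totalHamiltonian HS (Matrix.diagonal fun k => (E k : ℂ))) := by
  have hblock : ∀ k l, adMap HS (bathBlocks U k l) = ((E l - E k : ℝ) : ℂ) • bathBlocks U k l ↔
      bathBlocks U k l * (HS + (E l : ℂ) • 1) = (HS + (E k : ℂ) • 1) * bathBlocks U k l := by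
    intro k l
    change HS * _ - _ * HS = _ ↔ _
    rw [mul_add, add_mul, mul_smul_comm, smul_mul_assoc, mul_one, one_mul, Complex.ofReal_sub,
      sub_smul, sub_eq_sub_iff_add_eq_add, eq_comm, add_comm (_ • _)]
  rw [← bathBlocks_mem_unitary_iff, ← commute_map_iff (f := bathBlocks) (EquivLike.injective _),
    bathBlocks_totalHamiltonian, commute_iff_eq, ← Matrix.ext_iff]
  simp only [Matrix.mul_diagonal, Matrix.diagonal_mul, ← hblock]
  exact ⟨fun h => ⟨h.1, h.2⟩, fun h => ⟨h.1, h.2⟩⟩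

theorem isEnergyPreserving_one (HS : Matrix ι ι ℂ) (E : κ → ℝ) : IsEnergyPreserving HS E 1 where
  mem_unitary := one_mem _
  adMap_apply k l := by
    obtain rfl | h := eq_or_ne k l
    · simp [adMap]
    · simp [h]

namespace IsEnergyPreserving

variable {HS : Matrix ι ι ℂ} {E : κ → ℝ} {B : Matrix κ κ (Matrix ι ι ℂ)}

theorem eq_add_const (h : IsEnergyPreserving HS E B) {E' : κ → ℝ} {c : ℝ}
    (hE : ∀ k, E k = c + E' k) : IsEnergyPreserving HS E' B where
  mem_unitary := h.mem_unitary
  adMap_apply k l := by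
    have hdiff : E l - E k = E' l - E' k := by rw [hE, hE, add_sub_add_left_eq_sub]
    rw [h.adMap_apply, hdiff]

theorem submatrix (h : IsEnergyPreserving HS E B) {e : κ' → κ} (he : Function.Injective e)
    (hB : ∀ k j, k ∉ Set.range e → B k (e j) = 0) :
    IsEnergyPreserving HS (E ∘ e) (B.submatrix e e) where
  mem_unitary := by
    have hleft : star (B.submatrix e e) * B.submatrix e e = 1 := by
      ext1 i j
      have hsum : ∑ k, star (B (e k) (e i)) * B (e k) (e j) =
          ∑ k, star (B k (e i)) * B k (e j) :=
        Fintype.sum_of_injective e he _ _ (fun k hk => by rw [hB k j hk, mul_zero]) fun _ => rfl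
      have hone : ∑ k, star (B k (e i)) * B k (e j) = (1 : Matrix κ κ _) (e i) (e j) :=
        congr_fun₂ (Unitary.mem_iff.mp h.mem_unitary).1 (e i) (e j)
      exact hsum.trans (hone.trans (congr_fun₂ (Matrix.submatrix_one e he) i j))
    exact ⟨hleft, mul_eq_one_comm.mp hleft⟩
  adMap_apply k l := h.adMap_apply (e k) (e l)

theorem fromBlocks (h : IsEnergyPreserving HS E B) {E' : κ' → ℝ} {B' : Matrix κ' κ' (Matrix ι ι ℂ)}
    (h' : IsEnergyPreserving HS E' B') :
    IsEnergyPreserving HS (Sum.elim E E') (Matrix.fromBlocks B 0 0 B') where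
  mem_unitary := by
    obtain ⟨hl, hr⟩ := Unitary.mem_iff.mp h.mem_unitary
    obtain ⟨hl', hr'⟩ := Unitary.mem_iff.mp h'.mem_unitary
    simp only [Matrix.star_eq_conjTranspose] at hl hr hl' hr'
    simp [Unitary.mem_iff, Matrix.star_eq_conjTranspose, Matrix.fromBlocks_conjTranspose,
      Matrix.fromBlocks_multiply, hl, hr, hl', hr']
  adMap_apply := by
    rintro (k | k) (l | l)
    · exact h.adMap_apply k l
    · simp
    · simp
    · exact h'.adMap_apply k l

theorem blockDiagonal (h : IsEnergyPreserving HS E B) :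
    IsEnergyPreserving HS (E ∘ Prod.fst) (Matrix.blockDiagonal fun _ : κ' => B) where
  mem_unitary := by
    obtain ⟨hl, hr⟩ := Unitary.mem_iff.mp h.mem_unitary
    simp only [Matrix.star_eq_conjTranspose] at hl hr
    rw [Unitary.mem_iff, Matrix.star_eq_conjTranspose, Matrix.blockDiagonal_conjTranspose,
      ← Matrix.blockDiagonal_mul, ← Matrix.blockDiagonal_mul]
    simp only [hl, hr]
    exact ⟨Matrix.blockDiagonal_one, Matrix.blockDiagonal_one⟩
  adMap_apply k l := by
    rw [Matrix.blockDiagonal_apply]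
    split_ifs
    · exact h.adMap_apply k.1 l.1
    · simp

theorem sub_mem_spectrum_adMap (h : IsEnergyPreserving HS E B) {k l : κ} (hkl : B k l ≠ 0) :
    ((E l - E k : ℝ) : ℂ) ∈ spectrum ℂ (adMap HS) :=
  (Module.End.hasEigenvalue_of_hasEigenvector
    (Module.End.hasEigenvector_iff.mpr
      ⟨Module.End.mem_eigenspace_iff.mpr (h.adMap_apply k l), hkl⟩)).mem_spectrum

end IsEnergyPreserving

end EnergyPreserving

section Levels

variable {ι κ κ' : Type*} [Fintype ι] [DecidableEq ι] [Fintype κ] [Fintype κ']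

theorem levelChannel_submatrix {B : Matrix κ κ (Matrix ι ι ℂ)} {e : κ' → κ}
    (he : Function.Injective e) (hB : ∀ k j, k ∉ Set.range e → B k (e j) = 0) (j : κ') :
    levelChannel (B.submatrix e e) j = levelChannel B (e j) := by
  ext1 A
  simp only [levelChannel_apply, Matrix.submatrix_apply]
  refine Fintype.sum_of_injective e he _ _ (fun k hk => ?_) fun _ => rfl
  rw [hB k j hk, zero_mul, zero_mul]

theorem levelChannel_fromBlocks (B : Matrix κ κ (Matrix ι ι ℂ)) (B' : Matrix κ' κ' (Matrix ι ι ℂ)) :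
    levelChannel (Matrix.fromBlocks B 0 0 B') = Sum.elim (levelChannel B) (levelChannel B') := by
  ext1 (l | l) <;> ext1 A <;> simp [levelChannel_apply]

theorem levelChannel_blockDiagonal [DecidableEq κ'] (B : Matrix κ κ (Matrix ι ι ℂ)) (l : κ × κ') :
    levelChannel (Matrix.blockDiagonal fun _ : κ' => B) l = levelChannel B l.1 := by
  ext1 A
  simp [levelChannel_apply, Matrix.blockDiagonal_apply, Fintype.sum_prod_type]

end Levels

section Kronecker

variable {ι κ : Type*} [Fintype ι] [DecidableEq ι] [Fintype κ]

theorem one_kronecker_conj (V H : Matrix κ κ ℂ) (A : Matrix ι ι ℂ) :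
    A ⊗ₖ (V * H * Vᴴ) = (1 : Matrix ι ι ℂ) ⊗ₖ V * (A ⊗ₖ H) * ((1 : Matrix ι ι ℂ) ⊗ₖ V)ᴴ := by
  simp only [Matrix.conjTranspose_kronecker, ← Matrix.mul_kronecker_mul,
    Matrix.conjTranspose_one, one_mul, mul_one]

theorem partialTraceBath_mul_one_kronecker (X : Matrix (ι × κ) (ι × κ) ℂ) (V : Matrix κ κ ℂ) :
    partialTraceBath (X * (1 ⊗ₖ V)) = partialTraceBath ((1 ⊗ₖ V) * X) := by
  ext i j
  change ∑ k, _ = ∑ k, _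
  simp only [Matrix.mul_apply, Fintype.sum_prod_type_right, Matrix.kroneckerMap_apply,
    Matrix.one_apply, ite_mul, mul_ite, one_mul, zero_mul, mul_zero, Finset.sum_ite_eq,
    Finset.sum_ite_eq', Finset.mem_univ, if_true]
  rw [Finset.sum_comm]
  simp only [mul_comm]

end Kronecker

section Diagonalization

variable {ι κ : Type*} [Fintype ι] [DecidableEq ι] [Fintype κ] [DecidableEq κ]

theorem totalHamiltonian_conj (HS : Matrix ι ι ℂ) (H : Matrix κ κ ℂ) {V : Matrix κ κ ℂ}
    (hV : V ∈ Matrix.unitaryGroup κ ℂ) :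
    totalHamiltonian HS (V * H * Vᴴ) = (1 : Matrix ι ι ℂ) ⊗ₖ V * totalHamiltonian HS H *
      ((1 : Matrix ι ι ℂ) ⊗ₖ V)ᴴ := by
  have hone : (1 : Matrix κ κ ℂ) = V * 1 * Vᴴ := by
    rw [mul_one]
    exact (Matrix.mem_unitaryGroup_iff.mp hV).symm
  rw [totalHamiltonian, totalHamiltonian, mul_add, add_mul, ← one_kronecker_conj,
    ← one_kronecker_conj, ← hone]

theorem gibbsState_conj (t : ℝ) (H : Matrix κ κ ℂ) {V : Matrix κ κ ℂ}
    (hV : V ∈ Matrix.unitaryGroup κ ℂ) :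
    gibbsState t (V * H * Vᴴ) = V * gibbsState t H * Vᴴ := by
  have hmul : V * Vᴴ = 1 := Matrix.mem_unitaryGroup_iff.mp hV
  have hexp : NormedSpace.exp (-((1 / t : ℝ) : ℂ) • (V * H * Vᴴ)) =
      V * NormedSpace.exp (-((1 / t : ℝ) : ℂ) • H) * Vᴴ := by
    rw [← Matrix.inv_eq_right_inv hmul, ← Matrix.exp_conj _ _ (IsUnit.of_mul_eq_one _ hmul),
      mul_smul_comm, smul_mul_assoc]
  rw [gibbsState, hexp, Matrix.trace_mul_cycle, mul_eq_one_comm.mp hmul, one_mul, gibbsState,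
    mul_smul_comm, smul_mul_assoc]

theorem interactionMap_conj (t : ℝ) (H : Matrix κ κ ℂ) (U : Matrix (ι × κ) (ι × κ) ℂ)
    {V : Matrix κ κ ℂ} (hV : V ∈ Matrix.unitaryGroup κ ℂ) :
    interactionMap t (V * H * Vᴴ) U =
      interactionMap t H (((1 : Matrix ι ι ℂ) ⊗ₖ V)ᴴ * U * ((1 : Matrix ι ι ℂ) ⊗ₖ V)) := by
  let W : Matrix (ι × κ) (ι × κ) ℂ := 1 ⊗ₖ V
  have hW : W * Wᴴ = 1 :=
    Matrix.mem_unitaryGroup_iff.mp (Matrix.kronecker_mem_unitary (one_mem _) hV)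
  ext1 A
  calc partialTraceBath (U * (A ⊗ₖ gibbsState t (V * H * Vᴴ)) * Uᴴ)
      = partialTraceBath (W * (Wᴴ * (U * (W * (A ⊗ₖ gibbsState t H) * Wᴴ) * Uᴴ))) := by
        rw [gibbsState_conj t H hV, one_kronecker_conj, ← mul_assoc W, hW, one_mul]
    _ = partialTraceBath (Wᴴ * (U * (W * (A ⊗ₖ gibbsState t H) * Wᴴ) * Uᴴ) * W) :=
        (partialTraceBath_mul_one_kronecker _ V).symm
    _ = partialTraceBath (Wᴴ * U * W * (A ⊗ₖ gibbsState t H) * (Wᴴ * U * W)ᴴ) := by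
        simp only [Matrix.conjTranspose_mul, Matrix.conjTranspose_conjTranspose, mul_assoc]

theorem thermalMap_conj (T : ℝ≥0∞) (H : Matrix κ κ ℂ) (U : Matrix (ι × κ) (ι × κ) ℂ)
    {V : Matrix κ κ ℂ} (hV : V ∈ Matrix.unitaryGroup κ ℂ) :
    thermalMap T (V * H * Vᴴ) U =
      thermalMap T H (((1 : Matrix ι ι ℂ) ⊗ₖ V)ᴴ * U * ((1 : Matrix ι ι ℂ) ⊗ₖ V)) := by
  rw [thermalMap, thermalMap]
  split_ifs
  · rw [← interactionMap_conj 1 1 U hV, mul_one]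
    exact congrArg (interactionMap 1 · U) (Matrix.mem_unitaryGroup_iff.mp hV).symm
  · exact interactionMap_conj _ H U hV

end Diagonalization

section ThermalOperations

variable {ι : Type*} [Fintype ι] [DecidableEq ι] {HS : Matrix ι ι ℂ} {T : ℝ≥0∞} {r : ℝ}

theorem gibbsChannel_reindex {κ κ' : Type*} [Fintype κ] [Fintype κ'] (β : ℝ) (E : κ → ℝ)
    (B : Matrix κ κ (Matrix ι ι ℂ)) (e : κ' ≃ κ) :
    gibbsChannel β (E ∘ e) (B.submatrix e e) = gibbsChannel β E B := by
  have hlevel : levelChannel (B.submatrix e e) = levelChannel B ∘ e :=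
    funext (levelChannel_submatrix e.injective (by simp))
  simp only [gibbsChannel, Finset.centerMass, hlevel, Function.comp_apply]
  rw [e.sum_comp fun k => Real.exp (-β * E k),
    e.sum_comp fun k => Real.exp (-β * E k) • levelChannel B k]

theorem gibbsChannel_mem_TO {κ : Type*} [Fintype κ] [DecidableEq κ] [Nonempty κ] {E : κ → ℝ}
    {B : Matrix κ κ (Matrix ι ι ℂ)} (h : IsEnergyPreserving HS E B) :
    gibbsChannel T⁻¹.toReal E B ∈ TO HS T := by
  let e := (Fintype.equivFin κ).symm
  obtain ⟨U, hUB⟩ := EquivLike.surjective bathBlocks (B.submatrix e e)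
  have hU := h.submatrix e.injective (by simp)
  rw [← hUB, isEnergyPreserving_bathBlocks_iff] at hU
  refine ⟨Fintype.card κ, _, U, Fintype.card_pos, ?_, hU.1, (conj_eq_iff_commute hU.1).mpr hU.2, ?_⟩
  · exact Matrix.isHermitian_diagonal_of_self_adjoint _ (funext fun k => Complex.conj_ofReal _)
  · rw [thermalMap_diagonal, hUB, gibbsChannel_reindex]

theorem exists_gibbsChannel_of_mem_TO {S : Matrix ι ι ℂ →L[ℂ] Matrix ι ι ℂ} (hS : S ∈ TO HS T) :
    ∃ (m : ℕ) (E : Fin m → ℝ) (B : Matrix (Fin m) (Fin m) (Matrix ι ι ℂ)), 0 < m ∧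
      IsEnergyPreserving HS E B ∧ S = gibbsChannel T⁻¹.toReal E B := by
  obtain ⟨m, HB, U, hm, hHB, hU, hcomm, rfl⟩ := hS
  let V : Matrix (Fin m) (Fin m) ℂ := hHB.eigenvectorUnitary
  let E : Fin m → ℝ := hHB.eigenvalues
  have hV : V ∈ Matrix.unitaryGroup (Fin m) ℂ := hHB.eigenvectorUnitary.2
  have hdiag : HB = V * Matrix.diagonal (fun k => (E k : ℂ)) * Vᴴ := hHB.spectral_theorem
  have hW : (1 : Matrix ι ι ℂ) ⊗ₖ V ∈ Matrix.unitaryGroup (ι × Fin m) ℂ :=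
    Matrix.kronecker_mem_unitary (one_mem _) hV
  refine ⟨m, E, bathBlocks (((1 : Matrix ι ι ℂ) ⊗ₖ V)ᴴ * U * (1 ⊗ₖ V)), hm,
    isEnergyPreserving_bathBlocks_iff.mpr ⟨mul_mem (mul_mem (Unitary.star_mem hW) hU) hW, ?_⟩, ?_⟩
  · let φ := Unitary.conjStarAlgAut ℂ (Matrix (ι × Fin m) (ι × Fin m) ℂ) ⟨_, hW⟩
    have hφ : φ ((1 ⊗ₖ V)ᴴ * U * (1 ⊗ₖ V)) = U := φ.apply_symm_apply U
    have hcommute := (conj_eq_iff_commute hU).mp hcomm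
    rw [hdiag, totalHamiltonian_conj HS _ hV, ← hφ] at hcommute
    exact (commute_map_iff (f := φ) (EquivLike.injective φ)).mp hcommute
  · rw [← thermalMap_diagonal, ← thermalMap_conj T _ U hV, ← hdiag]

/-- The energies of a spin bath of gap `r` whose level `k` lies on the rung `f k` of the energy
ladder; rungs are counted from zero, so rung `j` has the energy `(j + 1) * r`. -/
def spinEnergy {κ : Type*} (r : ℝ) (f : κ → ℕ) (k : κ) : ℝ := ((f k : ℝ) + 1) * r

theorem spinHamiltonian_eq_diagonal (r : ℝ) {m : ℕ} (β : Fin m → ℕ) :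
    spinHamiltonian r β = Matrix.diagonal fun x => (spinEnergy r (fun x => (x.1 : ℕ)) x : ℂ) := by
  simp only [spinHamiltonian, Matrix.smul_one_eq_diagonal]
  exact Matrix.blockDiagonal'_diagonal _

theorem mem_TOSpin_iff {S : Matrix ι ι ℂ →L[ℂ] Matrix ι ι ℂ} :
    S ∈ TOSpin r HS T ↔ ∃ (m : ℕ) (β : Fin m → ℕ)
      (B : Matrix ((j : Fin m) × Fin (β j)) ((j : Fin m) × Fin (β j)) (Matrix ι ι ℂ)),
      0 < m ∧ (∀ j, 0 < β j) ∧ IsEnergyPreserving HS (spinEnergy r fun x => (x.1 : ℕ)) B ∧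
      S = gibbsChannel T⁻¹.toReal (spinEnergy r fun x => (x.1 : ℕ)) B := by
  constructor
  · rintro ⟨m, β, H, hm, hβ, hH, hc, rfl⟩
    rw [← commute_iff_lie_eq, spinHamiltonian_eq_diagonal] at hc
    refine ⟨m, β, bathBlocks (NormedSpace.exp (Complex.I • H)), hm, hβ,
      isEnergyPreserving_bathBlocks_iff.mpr ⟨exp_I_smul_mem_unitaryGroup hH, ?_⟩, ?_⟩
    · exact (hc.smul_left Complex.I).exp_left
    · rw [spinHamiltonian_eq_diagonal, thermalMap_diagonal]
  · rintro ⟨m, β, B, hm, hβ, hB, rfl⟩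
    obtain ⟨U, rfl⟩ := EquivLike.surjective bathBlocks B
    obtain ⟨hU, hc⟩ := isEnergyPreserving_bathBlocks_iff.mp hB
    obtain ⟨H, hH, rfl, hcomm⟩ := exists_isHermitian_exp_eq hU
    refine ⟨m, β, H, hm, hβ, hH, ?_, ?_⟩
    · rw [← commute_iff_lie_eq, spinHamiltonian_eq_diagonal]
      exact hcomm _ hc
    · rw [spinHamiltonian_eq_diagonal, thermalMap_diagonal]

theorem TOSpin_subset_TO : TOSpin r HS T ⊆ TO HS T := by
  intro S hS
  obtain ⟨m, β, B, hm, hβ, hB, rfl⟩ := mem_TOSpin_iff.mp hS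
  have : Nonempty ((j : Fin m) × Fin (β j)) := ⟨⟨⟨0, hm⟩, ⟨0, hβ _⟩⟩⟩
  exact gibbsChannel_mem_TO hB

theorem gibbsChannel_mem_TOSpin {κ : Type*} [Fintype κ] [DecidableEq κ] [Nonempty κ] {f : κ → ℕ}
    (hf : IsLowerSet (Set.range f)) {B : Matrix κ κ (Matrix ι ι ℂ)}
    (h : IsEnergyPreserving HS (spinEnergy r f) B) :
    gibbsChannel T⁻¹.toReal (spinEnergy r f) B ∈ TOSpin r HS T := by
  obtain ⟨M, hM⟩ : ∃ M, Set.range f = Set.Iio M :=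
    hf.eq_univ_or_Iio.resolve_left fun h => Set.infinite_univ (h ▸ Set.finite_range f)
  let g : κ → Fin M := fun k => ⟨f k, by simpa [hM] using Set.mem_range_self (f := f) k⟩
  let β : Fin M → ℕ := fun j => Fintype.card {k // g k = j}
  let e : ((j : Fin M) × Fin (β j)) ≃ κ :=
    (Equiv.sigmaCongrRight fun j => (Fintype.equivFin {k // g k = j}).symm).trans
      (Equiv.sigmaFiberEquiv g)
  have he : spinEnergy r f ∘ e = spinEnergy r fun x => (x.1 : ℕ) := by
    ext x
    have hge : g (e x) = x.1 := ((Fintype.equivFin {k // g k = x.1}).symm x.2).2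
    simp only [Function.comp_apply, spinEnergy, ← hge, g]
  have hβ : ∀ j, 0 < β j := fun j => by
    obtain ⟨k, hk⟩ : (j : ℕ) ∈ Set.range f := hM ▸ j.2
    exact Fintype.card_pos_iff.mpr ⟨⟨k, Fin.ext hk⟩⟩
  refine mem_TOSpin_iff.mpr ⟨M, β, B.submatrix e e, Fin.pos (g (Classical.arbitrary κ)), hβ,
    he ▸ h.submatrix e.injective (by simp), ?_⟩
  rw [← he, gibbsChannel_reindex]

end ThermalOperations

section Partition

variable {ι κ κ' : Type*} [Fintype ι] [DecidableEq ι] [Fintype κ] [Fintype κ']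

/-- The partition function of the bath levels `E` at the inverse temperature `β`. -/
noncomputable def partitionFunction (β : ℝ) (E : κ → ℝ) : ℝ := ∑ k, Real.exp (-β * E k)

theorem partitionFunction_pos [Nonempty κ] (β : ℝ) (E : κ → ℝ) : 0 < partitionFunction β E :=
  Finset.sum_pos (fun _ _ => Real.exp_pos _) Finset.univ_nonempty

theorem partitionFunction_comp_fst (β : ℝ) (E : κ → ℝ) :
    partitionFunction β (E ∘ Prod.fst : κ × κ' → ℝ) = Fintype.card κ' * partitionFunction β E := by
  simp [partitionFunction, Fintype.sum_prod_type, Finset.mul_sum]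

theorem partitionFunction_smul_gibbsChannel [Nonempty κ] (β : ℝ) (E : κ → ℝ)
    (B : Matrix κ κ (Matrix ι ι ℂ)) :
    partitionFunction β E • gibbsChannel β E B = ∑ l, Real.exp (-β * E l) • levelChannel B l :=
  smul_inv_smul₀ (partitionFunction_pos β E).ne' (∑ l, Real.exp (-β * E l) • levelChannel B l)

theorem gibbsChannel_fromBlocks [Nonempty κ] [Nonempty κ'] (β : ℝ) (E : κ → ℝ) (E' : κ' → ℝ)
    (B : Matrix κ κ (Matrix ι ι ℂ)) (B' : Matrix κ' κ' (Matrix ι ι ℂ)) :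
    gibbsChannel β (Sum.elim E E') (Matrix.fromBlocks B 0 0 B') =
      (partitionFunction β E + partitionFunction β E')⁻¹ •
        (partitionFunction β E • gibbsChannel β E B +
          partitionFunction β E' • gibbsChannel β E' B') := by
  rw [partitionFunction_smul_gibbsChannel, partitionFunction_smul_gibbsChannel, gibbsChannel,
    Finset.centerMass, levelChannel_fromBlocks, Fintype.sum_sum_type, Fintype.sum_sum_type]
  rfl

theorem gibbsChannel_blockDiagonal [Nonempty κ'] [DecidableEq κ'] (β : ℝ) (E : κ → ℝ)
    (B : Matrix κ κ (Matrix ι ι ℂ)) :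
    gibbsChannel β (E ∘ Prod.fst) (Matrix.blockDiagonal fun _ : κ' => B) = gibbsChannel β E B := by
  have hcard : (Fintype.card κ' : ℝ) ≠ 0 := Nat.cast_ne_zero.mpr Fintype.card_ne_zero
  simp only [gibbsChannel, Finset.centerMass, levelChannel_blockDiagonal, Fintype.sum_prod_type,
    Function.comp_apply, Finset.sum_const, Finset.card_univ, ← Finset.smul_sum]
  rw [← Nat.cast_smul_eq_nsmul ℝ, ← Nat.cast_smul_eq_nsmul ℝ, smul_eq_mul, mul_inv, mul_comm,
    smul_smul, mul_assoc, inv_mul_cancel₀ hcard, mul_one]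

end Partition

section Closure

variable {ι : Type*} [Fintype ι] [DecidableEq ι] {HS : Matrix ι ι ℂ} {T : ℝ≥0∞} {r : ℝ}

theorem spinEnergy_sumElim {κ κ' : Type*} (r : ℝ) (f : κ → ℕ) (f' : κ' → ℕ) :
    spinEnergy r (Sum.elim f f') = Sum.elim (spinEnergy r f) (spinEnergy r f') :=
  funext fun k => by cases k <;> rfl

theorem segment_subset_closure_TOSpin {κ κ' : Type*} [Fintype κ] [DecidableEq κ] [Nonempty κ]
    [Fintype κ'] [DecidableEq κ'] [Nonempty κ'] {f : κ → ℕ} {f' : κ' → ℕ}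
    (hf : IsLowerSet (Set.range f ∪ Set.range f')) {B : Matrix κ κ (Matrix ι ι ℂ)}
    (h : IsEnergyPreserving HS (spinEnergy r f) B) {B' : Matrix κ' κ' (Matrix ι ι ℂ)}
    (h' : IsEnergyPreserving HS (spinEnergy r f') B') :
    segment ℝ (gibbsChannel T⁻¹.toReal (spinEnergy r f) B)
      (gibbsChannel T⁻¹.toReal (spinEnergy r f') B') ⊆ closure (TOSpin r HS T) := by
  have : ContinuousSMul ℝ (Matrix ι ι ℂ →L[ℂ] Matrix ι ι ℂ) := IsScalarTower.continuousSMul ℂ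
  refine segment_subset_closure_of_nat_weights (partitionFunction_pos T⁻¹.toReal (spinEnergy r f))
    (partitionFunction_pos T⁻¹.toReal (spinEnergy r f')) fun m n hm hn => ?_
  have : Nonempty (Fin m) := Fin.pos_iff_nonempty.mp hm
  have : Nonempty (Fin n) := Fin.pos_iff_nonempty.mp hn
  let F : (κ × Fin m) ⊕ (κ' × Fin n) → ℕ := Sum.elim (f ∘ Prod.fst) (f' ∘ Prod.fst)
  let copies : Matrix _ _ (Matrix ι ι ℂ) :=
    Matrix.fromBlocks (Matrix.blockDiagonal fun _ : Fin m => B) 0 0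
      (Matrix.blockDiagonal fun _ : Fin n => B')
  have hF : spinEnergy r F =
      Sum.elim (spinEnergy r f ∘ Prod.fst) (spinEnergy r f' ∘ Prod.fst) :=
    spinEnergy_sumElim r _ _
  have hrange : IsLowerSet (Set.range F) := by
    rwa [Set.Sum.elim_range, Prod.fst_surjective.range_comp, Prod.fst_surjective.range_comp]
  have hcopies : IsEnergyPreserving HS (spinEnergy r F) copies :=
    hF ▸ h.blockDiagonal.fromBlocks h'.blockDiagonal
  have hmem := gibbsChannel_mem_TOSpin (T := T) hrange hcopies
  rwa [hF, gibbsChannel_fromBlocks, gibbsChannel_blockDiagonal, gibbsChannel_blockDiagonal,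
    partitionFunction_comp_fst, partitionFunction_comp_fst, Fintype.card_fin, Fintype.card_fin]
    at hmem

theorem isLowerSet_range_sigma_fst {m : ℕ} {β : Fin m → ℕ} (hβ : ∀ j, 0 < β j) :
    IsLowerSet (Set.range fun x : (j : Fin m) × Fin (β j) => (x.1 : ℕ)) := by
  have hsurj : Function.Surjective (Sigma.fst : ((j : Fin m) × Fin (β j)) → Fin m) :=
    fun j => ⟨⟨j, 0, hβ j⟩, rfl⟩
  have hrange := hsurj.range_comp Fin.val
  rw [Fin.range_val] at hrange
  exact hrange ▸ isLowerSet_Iio m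

theorem convex_closure_TOSpin : Convex ℝ (closure (TOSpin r HS T)) := by
  refine convex_closure_of_segment_subset fun S hS S' hS' => ?_
  obtain ⟨m, β, B, hm, hβ, hB, rfl⟩ := mem_TOSpin_iff.mp hS
  obtain ⟨m', β', B', hm', hβ', hB', rfl⟩ := mem_TOSpin_iff.mp hS'
  have : Nonempty ((j : Fin m) × Fin (β j)) := ⟨⟨⟨0, hm⟩, ⟨0, hβ _⟩⟩⟩
  have : Nonempty ((j : Fin m') × Fin (β' j)) := ⟨⟨⟨0, hm'⟩, ⟨0, hβ' _⟩⟩⟩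
  exact segment_subset_closure_TOSpin
    ((isLowerSet_range_sigma_fst hβ).union (isLowerSet_range_sigma_fst hβ')) hB hB'

theorem exists_eq_add_spinEnergy {κ : Type*} [Finite κ] {E : κ → ℝ}
    (hE : ∀ k l, E k - E l ∈ AddSubgroup.zmultiples r) :
    ∃ (c : ℝ) (f : κ → ℕ), ∀ k, E k = c + spinEnergy r f k := by
  cases isEmpty_or_nonempty κ with
  | inl h => exact ⟨0, fun _ => 0, fun k => h.elim k⟩
  | inr h =>
    obtain ⟨k₀⟩ := h
    choose n hn using fun k => AddSubgroup.mem_zmultiples_iff.mp (hE k k₀)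
    obtain ⟨a, ha⟩ := (Set.finite_range n).bddBelow
    refine ⟨E k₀ + (a - 1) * r, fun k => (n k - a).toNat, fun k => ?_⟩
    have hcast : (((n k - a).toNat : ℕ) : ℝ) = n k - a := by
      exact_mod_cast Int.toNat_of_nonneg (sub_nonneg.mpr (ha ⟨k, rfl⟩))
    have hk : n k * r = E k - E k₀ := by rw [← zsmul_eq_mul, hn]
    rw [spinEnergy, hcast]
    linear_combination -hk

theorem gibbsChannel_mem_closure_TOSpin_of_sub_mem_zmultiples {κ : Type*} [Fintype κ]
    [DecidableEq κ] [Nonempty κ] {E : κ → ℝ} (hE : ∀ k l, E k - E l ∈ AddSubgroup.zmultiples r)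
    {B : Matrix κ κ (Matrix ι ι ℂ)} (h : IsEnergyPreserving HS E B) :
    gibbsChannel T⁻¹.toReal E B ∈ closure (TOSpin r HS T) := by
  obtain ⟨c, f, hf⟩ := exists_eq_add_spinEnergy hE
  obtain ⟨M, hM⟩ := (Set.finite_range f).bddAbove
  have hrange : Set.range f ⊆ Set.range (Fin.val : Fin (M + 1) → ℕ) := by
    rw [Fin.range_val]
    exact fun j hj => Nat.lt_succ_of_le (hM hj)
  have hlower : IsLowerSet (Set.range f ∪ Set.range (Fin.val : Fin (M + 1) → ℕ)) := by
    rw [Set.union_eq_right.mpr hrange, Fin.range_val]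
    exact isLowerSet_Iio _
  rw [funext hf, gibbsChannel_const_add]
  -- An idle bath with one level on every rung fills the gaps of the ladder `f`.
  exact segment_subset_closure_TOSpin hlower (h.eq_add_const hf) (isEnergyPreserving_one HS _)
    (left_mem_segment ℝ _ _)

theorem gibbsChannel_mem_closure_TOSpin {κ : Type*} [Fintype κ] [DecidableEq κ] [Nonempty κ]
    (hBohr : ∀ ω : ℝ, (ω : ℂ) ∈ spectrum ℂ (adMap HS) → ω ∈ AddSubgroup.zmultiples r)
    {E : κ → ℝ} {B : Matrix κ κ (Matrix ι ι ℂ)} (h : IsEnergyPreserving HS E B) :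
    gibbsChannel T⁻¹.toReal E B ∈ closure (TOSpin r HS T) := by
  classical
  let energyClass : κ → ℝ ⧸ AddSubgroup.zmultiples r := fun k => (E k : ℝ)
  have hclass : ∀ {k l}, B k l ≠ 0 → energyClass k = energyClass l := fun {k l} hkl =>
    QuotientAddGroup.eq.mpr (neg_add_eq_sub (E k) (E l) ▸ hBohr _ (h.sub_mem_spectrum_adMap hkl))
  refine centerMass_mem_of_fiberwise convex_closure_TOSpin (fun _ => Real.exp_pos _) _ energyClass
    fun i => ?_
  let e : {k // energyClass k = energyClass i} → κ := Subtype.val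
  have hzero : ∀ k j, k ∉ Set.range e → B k (e j) = 0 := fun k j hk =>
    not_not.mp fun hne => hk ⟨⟨k, (hclass hne).trans j.2⟩, rfl⟩
  have hdiff : ∀ k l, (E ∘ e) k - (E ∘ e) l ∈ AddSubgroup.zmultiples r := fun k l =>
    neg_add_eq_sub (E l) (E k) ▸ QuotientAddGroup.eq.mp (l.2.trans k.2.symm)
  have : Nonempty {k // energyClass k = energyClass i} := ⟨⟨i, rfl⟩⟩
  have hmem := gibbsChannel_mem_closure_TOSpin_of_sub_mem_zmultiples (T := T) hdiff
    (h.submatrix Subtype.val_injective hzero)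
  rwa [gibbsChannel, funext (levelChannel_submatrix Subtype.val_injective hzero)] at hmem

end Closure

end ThermalOp

theorem corollary2_general {ι : Type*} [Fintype ι] [DecidableEq ι] (HS : Matrix ι ι ℂ) (r : ℝ)
    (hBohr : ∀ ω : ℝ, (ω : ℂ) ∈ spectrum ℂ (ThermalOp.adMap HS) → ω ∈ AddSubgroup.zmultiples r)
    (T : ℝ≥0∞) (_hT : 0 < T) :
    closure (ThermalOp.TO HS T) = closure (ThermalOp.TOSpin r HS T) := by
  have hsubset : ThermalOp.TO HS T ⊆ closure (ThermalOp.TOSpin r HS T) := by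
    intro S hS
    obtain ⟨m, E, B, hm, hB, rfl⟩ := ThermalOp.exists_gibbsChannel_of_mem_TO hS
    have : Nonempty (Fin m) := Fin.pos_iff_nonempty.mp hm
    exact ThermalOp.gibbsChannel_mem_closure_TOSpin hBohr hB
  exact (closure_minimal hsubset isClosed_closure).antisymm
    (closure_mono ThermalOp.TOSpin_subset_TO)

theorem corollary2 (n : ℕ) (HS : Matrix (Fin n) (Fin n) ℂ) (hHS : HS.IsHermitian)
    (r : ℝ) (hr : 0 < r)
    (hBohr : spectrum ℂ (ThermalOp.adMap HS) ⊆ Set.range fun k : ℤ => (r : ℂ) * (k : ℂ))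
    (T : ℝ≥0∞) (hT : 0 < T) :
    closure (ThermalOp.TO HS T) = closure (ThermalOp.TOSpin r HS T) :=
  corollary2_general HS r (fun _ hω => AddSubgroup.mem_zmultiples_iff.mpr <|
    (hBohr hω).imp fun k (hk : (r : ℂ) * k = _) => by
      rw [zsmul_eq_mul, mul_comm]; exact_mod_cast hk) T hT
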